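/- For $x\in\mathbb T=\mathbb R/\mathbb Z$ write $e(x)=e^{2\pi i x}$, and for $h\in L^1(\mathbb T)$ let $$\|h\|_*=\sup_{I\subset\mathbb T}\frac1{|I|}\int_I|h-h_I|\in[0,\infty],\qquad h_I=\frac1{|I|}\int_I h,$$ where $I$ runs over all intervals (arcs) of positive length in $\mathbb T$. For every integer $k>1$ and every integer $m\ge 0$ the series $\sum_{n=m+1}^\infty \frac{e(n^kx)}{n}$ converges (unconditionally) in $L^2(\mathbb T)$, and there is an absolute constant $C>0$ such that for all integers $m\ge 0$ and $k>1$ $$\Big\|\sum_{n=m+1}^{\infty}\frac{e(n^kx)}{n}\Big\|_*\ge\frac Ck .$$ Consequently, for every integer $k>1$, the partial sums $\sum_{n=1}^N \frac{e(n^kx)}{n}$ do not converge in the BMO norm to $F_k(x)=\sum_{n=1}^\infty\frac{e(n^kx)}{n}$ as $N\to\infty$, i.e. $\big\|\sum_{n=1}^N\frac{e(n^kx)}n-F_k\big\|_*\not\to0$. -/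

import Mathlib

open MeasureTheory Filter Topology
open scoped ENNReal

noncomputable section

namespace RiemannSeries

/-- The space `L²(𝕋)`, `𝕋 = ℝ/ℤ`, with respect to the normalized Lebesgue measure. -/
abbrev L2T : Type := Lp ℂ 2 (AddCircle.haarAddCircle (T := (1 : ℝ)))

/-- The mean oscillation `|I|⁻¹ ∫_I |h - h_I|` of a function on the circle over the arc
`I` that is the image of `(a, b]`, where `h_I` is the average of `h` on `I`. -/
def meanOsc (h : UnitAddCircle → ℂ) (a b : ℝ) : ℝ≥0∞ :=
  (ENNReal.ofReal (b - a))⁻¹ * ∫⁻ x in Set.Ioc a b,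
    ‖h (x : UnitAddCircle) - ⨍ y in Set.Ioc a b, h (y : UnitAddCircle)‖ₑ

/-- The BMO norm on the circle: the supremum of the mean oscillations over all arcs
(intervals of positive length at most `1`); it takes the value `∞` outside BMO. -/
def bmoNorm (h : UnitAddCircle → ℂ) : ℝ≥0∞ :=
  ⨆ (a : ℝ) (b : ℝ) (_ : a < b) (_ : b ≤ a + 1), meanOsc h a b

/-- The function `x ↦ e(n ^ k x) / n`, where `e(x) = exp(2πix)`, as an element of `L²(𝕋)`. -/
def term (k n : ℕ) : L2T :=
  (1 / (n : ℂ)) • (fourierLp 2 ((n : ℤ) ^ k) : L2T)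

/-- The tail `∑_{n ≥ m + 1} e(n ^ k x) / n`, a series in `L²(𝕋)`. -/
def tail (k m : ℕ) : L2T := ∑' n : ℕ, term k (m + 1 + n)

/-- The function `F_k = ∑_{n ≥ 1} e(n ^ k x) / n`. -/
def F (k : ℕ) : L2T := ∑' n : ℕ, term k (n + 1)

/-- The partial sum `∑_{n = 1}^N e(n ^ k x) / n`. -/
def partialSum (k N : ℕ) : L2T := ∑ n ∈ Finset.Icc 1 N, term k n

end RiemannSeries

end

namespace RiemannSeries

open Complex

/-! Test against the sign function on `(-δ, δ]`. It has mean zero, so its pairing with `f`, divided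
by `2δ`, is at most the mean oscillation of `f` there (`signPairing_le_bmoNorm`). Its pairing with
`e(Nx)` is `i(1 - cos 2πNδ)/(πN)`, so for `N > 0` the imaginary parts are nonnegative and the terms
of the tail cannot cancel. As the pairing is continuous on `L²`, it can be applied termwise to the
series.

With `M = k(m+1)` and `δ = 1/(4M^k)`, every `n` in `[M, M(1+1/k)]` has `n^k δ` in `[1/4, 3/4]`,
where the cosine is nonpositive. About `m+1` such `n` each contribute at least a constant times
`δ/((m+1)k)`, in total a constant times `δ/k`. The bound is uniform in `m`, which rules out BMO
convergence. -/

/-- The arc of the circle that is the image of `(a, b]`, when `a < b ≤ a + 1`. -/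
def arc (a b : ℝ) : Set UnitAddCircle :=
  {x | ((AddCircle.equivIoc (1 : ℝ) a x : Set.Ioc a (a + 1)) : ℝ) ∈ Set.Ioc a b}

lemma measurableSet_arc (a b : ℝ) : MeasurableSet (arc a b) :=
  (measurable_subtype_coe.comp (AddCircle.measurableEquivIoc (1 : ℝ) a).measurable)
    measurableSet_Ioc

lemma coe_mem_arc_iff {a b x : ℝ} (hx : x ∈ Set.Ioc a (a + 1)) :
    (x : UnitAddCircle) ∈ arc a b ↔ x ∈ Set.Ioc a b := by
  unfold arc
  rw [Set.mem_ofPred_eq, AddCircle.equivIoc_coe_eq hx]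

lemma haarAddCircle_eq_volume :
    (AddCircle.haarAddCircle (T := (1 : ℝ))) = (volume : Measure UnitAddCircle) := by
  have h := AddCircle.volume_eq_smul_haarAddCircle (T := (1 : ℝ))
  rw [ENNReal.ofReal_one, one_smul] at h
  exact h.symm

lemma setIntegral_arc {a b : ℝ} (hb : b ≤ a + 1) (f : UnitAddCircle → ℂ) :
    ∫ x in arc a b, f x ∂(AddCircle.haarAddCircle (T := (1 : ℝ)))
      = ∫ x in Set.Ioc a b, f (x : UnitAddCircle) := by
  rw [haarAddCircle_eq_volume, ← integral_indicator (measurableSet_arc a b),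
    ← UnitAddCircle.integral_preimage a]
  have h : ∀ x ∈ Set.Ioc a (a + 1), (arc a b).indicator f (x : UnitAddCircle)
      = (Set.Ioc a b).indicator (fun y : ℝ => f (y : UnitAddCircle)) x := by
    intro x hx
    by_cases hxb : x ∈ Set.Ioc a b
    · rw [Set.indicator_of_mem hxb, Set.indicator_of_mem ((coe_mem_arc_iff hx).2 hxb)]
    · rw [Set.indicator_of_notMem hxb,
        Set.indicator_of_notMem (fun h => hxb ((coe_mem_arc_iff hx).1 h))]
  rw [setIntegral_congr_fun measurableSet_Ioc h, setIntegral_indicator measurableSet_Ioc,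
    Set.inter_eq_right.2 (Set.Ioc_subset_Ioc_right hb)]

lemma integrableOn_Ioc_coe {a b : ℝ} (hb : b ≤ a + 1) (f : L2T) :
    IntegrableOn (fun x : ℝ => f (x : UnitAddCircle)) (Set.Ioc a b) := by
  have h : Integrable f (volume : Measure UnitAddCircle) := by
    rw [← haarAddCircle_eq_volume]
    exact (Lp.memLp f).integrable one_le_two
  have h' := (UnitAddCircle.measurePreserving_mk a).integrable_comp_of_integrable h
  exact IntegrableOn.mono_set h' (Set.Ioc_subset_Ioc_right hb)

/-- Integration over the arc `(a, b]` as a continuous linear functional on `L²(𝕋)`. -/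
noncomputable def arcIntegral (a b : ℝ) : L2T →L[ℂ] ℂ :=
  innerSL ℂ (indicatorConstLp 2 (measurableSet_arc a b) (measure_ne_top _ _) (1 : ℂ))

lemma arcIntegral_eq_haar (a b : ℝ) (f : L2T) :
    arcIntegral a b f = ∫ x in arc a b, f x ∂(AddCircle.haarAddCircle (T := (1 : ℝ))) :=
  L2.inner_indicatorConstLp_one _ _ f

lemma arcIntegral_apply {a b : ℝ} (hb : b ≤ a + 1) (f : L2T) :
    arcIntegral a b f = ∫ x in Set.Ioc a b, f (x : UnitAddCircle) := by
  rw [arcIntegral_eq_haar, setIntegral_arc hb]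

lemma arcIntegral_fourierLp {a b : ℝ} (hab : a ≤ b) (hb : b ≤ a + 1) {N : ℤ} (hN : N ≠ 0) :
    arcIntegral a b (fourierLp 2 N)
      = (exp (2 * Real.pi * I * N * b) - exp (2 * Real.pi * I * N * a))
        / (2 * Real.pi * I * N) := by
  have hc : (2 * Real.pi * I * N : ℂ) ≠ 0 := by
    simp [Real.pi_ne_zero, hN]
  rw [arcIntegral_eq_haar, setIntegral_congr_ae (g := fun x => fourier N x) (measurableSet_arc a b)
    ((coeFn_fourierLp 2 N).mono fun x hx _ => hx), setIntegral_arc hb,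
    ← integral_exp_mul_complex hc, intervalIntegral.integral_of_le hab]
  refine setIntegral_congr_fun measurableSet_Ioc fun x _ => ?_
  simp

/-- The pairing of a function with the sign function on `(-δ, δ]`. -/
noncomputable def signPairing (δ : ℝ) : L2T →L[ℂ] ℂ := arcIntegral 0 δ - arcIntegral (-δ) 0

lemma signPairing_fourierLp {δ : ℝ} (hδ : 0 ≤ δ) (hδ' : δ ≤ 1) {N : ℤ} (hN : N ≠ 0) :
    signPairing δ (fourierLp 2 N)
      = (((1 - Real.cos (2 * Real.pi * N * δ)) / (Real.pi * N) : ℝ) : ℂ) * I := by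
  have hN' : (N : ℂ) ≠ 0 := by exact_mod_cast hN
  have hpi : (Real.pi : ℂ) ≠ 0 := by exact_mod_cast Real.pi_ne_zero
  rw [signPairing, sub_apply, arcIntegral_fourierLp hδ (by linarith) hN,
    arcIntegral_fourierLp (by linarith) (by linarith) hN]
  push_cast
  rw [Complex.cos]
  have h1 : (2 * Real.pi * I * N * δ : ℂ) = 2 * Real.pi * N * δ * I := by ring
  have h2 : (2 * Real.pi * I * N * -δ : ℂ) = -(2 * Real.pi * N * δ) * I := by ring
  rw [h1, h2]
  field_simp
  simp
  ring_nf

/-- Duality: the pairing with the sign function bounds the BMO norm from below. -/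
lemma signPairing_le_bmoNorm {δ : ℝ} (hδ : 0 < δ) (hδ' : 2 * δ ≤ 1) (f : L2T) :
    ENNReal.ofReal (‖signPairing δ f‖ / (2 * δ)) ≤ bmoNorm f := by
  have key : ENNReal.ofReal (‖signPairing δ f‖ / (2 * δ)) ≤ meanOsc f (-δ) δ := by
    unfold meanOsc
    set c := ⨍ y in Set.Ioc (-δ) δ, f (y : UnitAddCircle) with hc
    have hunion : Set.Ioc (-δ) δ = Set.Ioc (-δ) 0 ∪ Set.Ioc 0 δ :=
      (Set.Ioc_union_Ioc_eq_Ioc (by linarith) hδ.le).symm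
    have hdisj : Disjoint (Set.Ioc (-δ) 0) (Set.Ioc 0 δ) := Set.Ioc_disjoint_Ioc_of_le le_rfl
    -- The two halves have equal length, so the constant `c` cancels.
    have hpair : signPairing δ f = (∫ x in Set.Ioc 0 δ, (f (x : UnitAddCircle) - c))
        - ∫ x in Set.Ioc (-δ) 0, (f (x : UnitAddCircle) - c) := by
      rw [integral_sub (integrableOn_Ioc_coe (by linarith) f) (by simp),
        integral_sub (integrableOn_Ioc_coe (by linarith) f) (by simp), signPairing,
        sub_apply, arcIntegral_apply (by linarith),
        arcIntegral_apply (by linarith)]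
      simp [hδ.le]
    rw [ENNReal.ofReal_div_of_pos (by linarith), ofReal_norm, ENNReal.div_eq_inv_mul,
      show δ - -δ = 2 * δ by ring]
    gcongr
    rw [hunion, lintegral_union measurableSet_Ioc hdisj, hpair, add_comm]
    refine enorm_sub_le.trans ?_
    gcongr <;> exact enorm_integral_le_lintegral_enorm _
  refine key.trans ?_
  unfold bmoNorm
  exact le_iSup_of_le (-δ) (le_iSup_of_le δ (le_iSup_of_le (by linarith)
    (le_iSup_of_le (by linarith) le_rfl)))

/-- The frequencies `n^k` are distinct, so the terms are orthogonal and `∑ 1/n² < ∞` suffices. -/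
lemma summable_term (m k : ℕ) (hk : k ≠ 0) : Summable (fun n : ℕ => term k (m + 1 + n)) := by
  have hinj : Function.Injective (fun n : ℕ => ((m + 1 + n : ℕ) : ℤ) ^ k) := by
    intro a b hab
    have h : (m + 1 + a) ^ k = (m + 1 + b) ^ k := by
      dsimp only at hab
      exact_mod_cast hab
    have := Nat.pow_left_injective hk h
    omega
  have horth := ((orthonormal_fourier (T := (1 : ℝ))).comp _ hinj).orthogonalFamily
  have h := (horth.summable_iff_norm_sq_summable (fun n : ℕ => 1 / ((m + 1 + n : ℕ) : ℂ))).2 ?_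
  · simpa [term] using h
  · have := (summable_nat_add_iff (m + 1)).2 (Real.summable_one_div_nat_pow.2 one_lt_two)
    refine this.congr fun n => ?_
    rw [norm_div, norm_one, Complex.norm_natCast, div_pow, one_pow, add_comm n]

/-- The imaginary part of the pairing of the `n`-th term with the sign function. -/
lemma signPairing_term_im {δ : ℝ} (hδ : 0 ≤ δ) (hδ' : δ ≤ 1) {k n : ℕ} (hn : n ≠ 0) :
    (signPairing δ (term k n)).im
      = 1 / n * ((1 - Real.cos (2 * Real.pi * (n ^ k * δ))) / (Real.pi * n ^ k)) := by
  have hN : ((n : ℤ) ^ k) ≠ 0 := pow_ne_zero _ (by exact_mod_cast hn)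
  rw [term, map_smul, signPairing_fourierLp hδ hδ' hN, smul_eq_mul,
    show (1 / (n : ℂ)) = ((1 / n : ℝ) : ℂ) by push_cast; rfl, Complex.im_ofReal_mul,
    Complex.im_ofReal_mul, Complex.I_im, mul_one]
  push_cast
  rw [mul_assoc (2 * Real.pi)]

lemma one_add_inv_pow_le_three {k : ℕ} (hk : k ≠ 0) : (1 + 1 / (k : ℝ)) ^ k ≤ 3 := by
  have hk' : (k : ℝ) ≠ 0 := by exact_mod_cast hk
  calc (1 + 1 / (k : ℝ)) ^ k ≤ Real.exp (1 / k) ^ k := by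
        gcongr
        linarith [Real.add_one_le_exp (1 / (k : ℝ))]
    _ = Real.exp 1 := by rw [← Real.exp_nat_mul]; congr 1; field_simp
    _ ≤ 3 := by linarith [Real.exp_one_lt_d9]

lemma le_norm_signPairing_tail (m : ℕ) {k : ℕ} (hk : 1 < k) :
    ∃ δ : ℝ, 0 < δ ∧ 2 * δ ≤ 1 ∧
      1 / (3 * Real.pi) / k ≤ ‖signPairing δ (tail k m)‖ / (2 * δ) := by
  set j : ℕ := m + 1 with hj
  set M : ℕ := k * j with hM
  have hM1 : 1 ≤ M := Nat.mul_pos (by omega) (by omega)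
  have hMR : (1 : ℝ) ≤ (M : ℝ) ^ k := one_le_pow₀ (by exact_mod_cast hM1)
  have hkR : (1 : ℝ) < k := by exact_mod_cast hk
  have hjR : (0 : ℝ) < j := by positivity
  -- Chosen so that `n^k δ` equals `1/4` at `n = M`; up to `n = M(1+1/k) = M + j` it grows by a
  -- factor at most `3`.
  set δ : ℝ := 1 / (4 * (M : ℝ) ^ k) with hδ
  have hδ0 : 0 < δ := by positivity
  have hδ1 : 4 * δ ≤ 1 := by
    rw [hδ, mul_one_div, div_le_one (by positivity)]
    linarith
  refine ⟨δ, hδ0, by linarith, ?_⟩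
  have hsum : HasSum (fun n : ℕ => (signPairing δ (term k (m + 1 + n))).im)
      (signPairing δ (tail k m)).im :=
    Complex.hasSum_im ((signPairing δ).hasSum (summable_term m k (by omega)).hasSum)
  have hnonneg : ∀ n : ℕ, 0 ≤ (signPairing δ (term k (m + 1 + n))).im := by
    intro n
    rw [signPairing_term_im hδ0.le (by linarith) (by omega)]
    have := Real.cos_le_one (2 * Real.pi * (((m + 1 + n : ℕ) : ℝ) ^ k * δ))
    have : 0 ≤ 1 - Real.cos (2 * Real.pi * (((m + 1 + n : ℕ) : ℝ) ^ k * δ)) := by linarith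
    positivity
  have hterm : ∀ n : ℕ, M ≤ n → n ≤ M + j →
      2 * δ * (2 / (3 * Real.pi)) / (j * (k + 1)) ≤ (signPairing δ (term k n)).im := by
    intro n hn hn'
    have hn1 : 1 ≤ n := hM1.trans hn
    have hnR : (0 : ℝ) < n := by exact_mod_cast hn1
    rw [signPairing_term_im hδ0.le (by linarith) (by omega)]
    have hlow : 1 / 4 ≤ (n : ℝ) ^ k * δ := by
      rw [hδ, mul_one_div, div_le_div_iff₀ (by norm_num) (by positivity)]
      have : (M : ℝ) ^ k ≤ (n : ℝ) ^ k := by gcongr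
      linarith
    have hnle : (n : ℝ) ≤ j * (k + 1) := by
      have : (n : ℝ) ≤ (M : ℝ) + j := by exact_mod_cast hn'
      rw [hM] at this
      push_cast at this ⊢
      linarith
    have hupp : (n : ℝ) ^ k * δ ≤ 3 / 4 := by
      rw [hδ, mul_one_div, div_le_div_iff₀ (by positivity) (by norm_num)]
      have : (n : ℝ) ^ k ≤ (M : ℝ) ^ k * 3 := by
        calc (n : ℝ) ^ k ≤ ((M : ℝ) * (1 + 1 / k)) ^ k := by
              gcongr
              refine hnle.trans (le_of_eq ?_)
              rw [hM]
              push_cast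
              field_simp
          _ = (M : ℝ) ^ k * (1 + 1 / k) ^ k := mul_pow _ _ _
          _ ≤ _ := by gcongr; exact one_add_inv_pow_le_three (by omega)
      linarith
    have hcos : Real.cos (2 * Real.pi * ((n : ℝ) ^ k * δ)) ≤ 0 := by
      apply Real.cos_nonpos_of_pi_div_two_le_of_le <;> nlinarith [Real.pi_pos]
    -- Uses `n ≤ j(k+1)`, `1 - cos ≥ 1` and `n^k ≤ (3/4)/δ`.
    calc 2 * δ * (2 / (3 * Real.pi)) / (j * (k + 1))
        = 1 / (j * (k + 1)) * (1 / (Real.pi * (3 / 4 / δ))) := by field_simp; ring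
      _ ≤ 1 / n * ((1 - Real.cos (2 * Real.pi * ((n : ℝ) ^ k * δ))) / (Real.pi * n ^ k)) := by
          gcongr
          · linarith
          · linarith
          · exact (le_div_iff₀ hδ0).2 hupp
  -- The shift `m + 1 + n = j + n` turns this window into the `j` frequencies' indices in `[M, M +
  -- j)`.
  have hfin := sum_le_hasSum (Finset.Ico (M - j) M) (fun n _ => hnonneg n) hsum
  have hMj : j ≤ M := Nat.le_mul_of_pos_left _ (by omega)
  have hcard : (j : ℝ) * (2 * δ * (2 / (3 * Real.pi)) / (j * (k + 1)))
      ≤ ∑ n ∈ Finset.Ico (M - j) M, (signPairing δ (term k (m + 1 + n))).im := by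
    have := Finset.card_nsmul_le_sum (Finset.Ico (M - j) M)
      (fun n => (signPairing δ (term k (m + 1 + n))).im)
      (2 * δ * (2 / (3 * Real.pi)) / (j * (k + 1))) (fun n hn => by
        rw [Finset.mem_Ico] at hn
        exact hterm _ (by omega) (by omega))
    rwa [Nat.card_Ico, Nat.sub_sub_self hMj, nsmul_eq_mul] at this
  rw [le_div_iff₀ (by positivity)]
  calc 1 / (3 * Real.pi) / k * (2 * δ)
      ≤ (j : ℝ) * (2 * δ * (2 / (3 * Real.pi)) / (j * (k + 1))) := by
        rw [show (j : ℝ) * (2 * δ * (2 / (3 * Real.pi)) / (j * (k + 1)))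
          = 1 / (3 * Real.pi) * (2 / (k + 1)) * (2 * δ) by field_simp, div_eq_mul_one_div]
        -- What remains is `1/k ≤ 2/(k+1)`.
        refine mul_le_mul_of_nonneg_right (mul_le_mul_of_nonneg_left ?_ (by positivity))
          (by positivity)
        rw [div_le_div_iff₀ (by linarith) (by linarith)]
        linarith
    _ ≤ (signPairing δ (tail k m)).im := hcard.trans hfin
    _ ≤ ‖signPairing δ (tail k m)‖ := (le_abs_self _).trans (Complex.abs_im_le_norm _)

lemma le_bmoNorm_tail (m : ℕ) {k : ℕ} (hk : 1 < k) :
    ENNReal.ofReal (1 / (3 * Real.pi) / k) ≤ bmoNorm (tail k m) := by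
  obtain ⟨δ, h0, h1, h⟩ := le_norm_signPairing_tail m hk
  exact (ENNReal.ofReal_le_ofReal h).trans (signPairing_le_bmoNorm h0 h1 _)

/-- The error of the partial sum is minus a tail; the norm of the pairing ignores the sign. -/
lemma le_bmoNorm_neg_tail (m : ℕ) {k : ℕ} (hk : 1 < k) :
    ENNReal.ofReal (1 / (3 * Real.pi) / k) ≤ bmoNorm (-tail k m : L2T) := by
  obtain ⟨δ, h0, h1, h⟩ := le_norm_signPairing_tail m hk
  rw [← norm_neg, ← map_neg] at h
  exact (ENNReal.ofReal_le_ofReal h).trans (signPairing_le_bmoNorm h0 h1 _)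

lemma partialSum_sub_F (N : ℕ) {k : ℕ} (hk : k ≠ 0) : partialSum k N - F k = -tail k N := by
  have hs : Summable (fun n : ℕ => term k (n + 1)) := by
    simpa [add_comm] using summable_term 0 k hk
  have hp : partialSum k N = ∑ n ∈ Finset.range N, term k (n + 1) := by
    rw [partialSum, ← Finset.Ico_add_one_right_eq_Icc, Finset.sum_Ico_eq_sum_range]
    simp [add_comm]
  have ht : tail k N = ∑' n : ℕ, term k (n + N + 1) :=
    tsum_congr fun n => by congr 1; omega
  rw [F, ← hs.sum_add_tsum_nat_add N, hp, ht]
  abel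

end RiemannSeries

theorem proposition1 :
    (∀ m k : ℕ, 1 < k → Summable (fun n : ℕ => RiemannSeries.term k (m + 1 + n))) ∧
    (∃ C : ℝ, 0 < C ∧ ∀ m k : ℕ, 1 < k →
      ENNReal.ofReal (C / k) ≤ RiemannSeries.bmoNorm (RiemannSeries.tail k m)) ∧
    (∀ k : ℕ, 1 < k →
      ¬ Tendsto (fun N : ℕ =>
          RiemannSeries.bmoNorm (RiemannSeries.partialSum k N - RiemannSeries.F k : RiemannSeries.L2T))
        atTop (𝓝 0)) := by
  refine ⟨fun m k hk => RiemannSeries.summable_term m k (by omega),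
    ⟨1 / (3 * Real.pi), by positivity, fun m k hk => RiemannSeries.le_bmoNorm_tail m hk⟩,
    fun k hk h => ?_⟩
  have hle : ENNReal.ofReal (1 / (3 * Real.pi) / k) ≤ 0 := by
    refine ge_of_tendsto' h fun N => ?_
    rw [RiemannSeries.partialSum_sub_F N (by omega)]
    exact RiemannSeries.le_bmoNorm_neg_tail N hk
  have hk0 : (0 : ℝ) < k := by exact_mod_cast (by omega : 0 < k)
  exact absurd (ENNReal.ofReal_pos.2 (by positivity : 0 < 1 / (3 * Real.pi) / (k : ℝ)))
    (not_lt.2 hle)
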